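/- Let $G$ be a finite nilpotent group and let $p$ be a prime. For $h\in G$ put $\tilde h=\sum_{x\in\langle h\rangle}x\in\mathbb{Z}G$, and for $g,h\in G$ and a positive integer $k$ define the Bovdi units $$b_k(g,\tilde h)=h^k+(1-h)\,g\,\tilde h,\qquad b_k(\tilde h,g)=h^k+\tilde h\,g\,(1-h),$$ which are elements of the unit group $\mathcal{U}(\mathbb{Z}G)$ of the integral group ring. Let ${}^*$ denote the classical involution of $\mathbb{Z}G$, i.e. the $\mathbb{Z}$-linear map with $x^*=x^{-1}$ for $x\in G$, let $C_p$ denote the cyclic group of order $p$, and let $\star$ denote the free product of groups. (1) Let $g,h\in G$ be such that the order of $h$ is $p$ and $g\notin N_G(\langle h\rangle)$, the normalizer of $\langle h\rangle$ in $G$. Then, for all integers $1\le k,l\le p-1$, $$\langle b_k(g,\tilde h),\,b_l(g,\tilde h)^*\rangle\;\cong\; C_p\star C_p\;\cong\;\langle b_k(g,\tilde h),\,b_l(\tilde h,g^{-1})\rangle ,$$ where $\langle\cdot,\cdot\rangle$ denotes the subgroup of $\mathcal{U}(\mathbb{Z}G)$ generated by the two elements. (2) Conversely, if $\mathcal{U}(\mathbb{Z}G)$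 contains a subgroup isomorphic to $C_p\star C_p$, then there exist $g,h\in G$ such that $h$ has order $p$ and $g\notin N_G(\langle h\rangle)$. -/

import Mathlib

/-! Bovdi units in the integral group ring `MonoidAlgebra ℤ G` of a finite group `G`. -/

namespace BovdiUnits

open MonoidAlgebra

/-- The sum in `ℤG` of the elements of a subset `S` of the finite group `G`. -/
noncomputable def tildeSet {G : Type*} [Group G] [Finite G] (S : Set G) : MonoidAlgebra ℤ G :=
  ∑ x ∈ S.toFinite.toFinset, of ℤ G x

/-- The sum in `ℤG` of the elements of the cyclic subgroup generated by `h`. -/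
noncomputable def tilde {G : Type*} [Group G] [Finite G] (h : G) : MonoidAlgebra ℤ G :=
  tildeSet (Subgroup.zpowers h : Set G)

/-- The classical involution of `ℤG`: the `ℤ`-linear map that sends each `x ∈ G` to `x⁻¹`. -/
noncomputable def involution {G : Type*} [Group G] (a : MonoidAlgebra ℤ G) :
    MonoidAlgebra ℤ G :=
  mapDomain (fun x : G => x⁻¹) a

theorem of_mul_tilde {G : Type*} [Group G] [Finite G] (h : G) :
    of ℤ G h * tilde h = tilde h := by
  unfold tilde tildeSet
  rw [Finset.mul_sum]
  refine Finset.sum_equiv (Equiv.mulLeft h) ?_ ?_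
  · intro x
    simp [Subgroup.mul_mem_cancel_left _ (Subgroup.mem_zpowers h)]
  · intro x _
    simp [map_mul]

theorem tilde_mul_of {G : Type*} [Group G] [Finite G] (h : G) :
    tilde h * of ℤ G h = tilde h := by
  unfold tilde tildeSet
  rw [Finset.sum_mul]
  refine Finset.sum_equiv (Equiv.mulRight h) ?_ ?_
  · intro x
    simp [Subgroup.mul_mem_cancel_right _ (Subgroup.mem_zpowers h)]
  · intro x _
    simp [map_mul]

theorem of_pow_mul_tilde {G : Type*} [Group G] [Finite G] (h : G) (k : ℕ) :
    of ℤ G (h ^ k) * tilde h = tilde h := by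
  induction k with
  | zero => rw [pow_zero, map_one, one_mul]
  | succ k ih => rw [pow_succ, map_mul, mul_assoc, of_mul_tilde, ih]

theorem tilde_mul_of_pow {G : Type*} [Group G] [Finite G] (h : G) (k : ℕ) :
    tilde h * of ℤ G (h ^ k) = tilde h := by
  induction k with
  | zero => rw [pow_zero, map_one, mul_one]
  | succ k ih => rw [pow_succ, map_mul, ← mul_assoc, ih, tilde_mul_of]

theorem of_mul_of_inv {G : Type*} [Group G] (x : G) : of ℤ G x * of ℤ G x⁻¹ = 1 := by
  rw [← map_mul, mul_inv_cancel, map_one]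

theorem of_inv_mul_of {G : Type*} [Group G] (x : G) : of ℤ G x⁻¹ * of ℤ G x = 1 := by
  rw [← map_mul, inv_mul_cancel, map_one]

theorem of_pow_inv_mul_tilde {G : Type*} [Group G] [Finite G] (h : G) (k : ℕ) :
    of ℤ G (h ^ k)⁻¹ * tilde h = tilde h := by
  conv_lhs => rw [← of_pow_mul_tilde h k, ← mul_assoc, of_inv_mul_of, one_mul]

theorem tilde_mul_of_pow_inv {G : Type*} [Group G] [Finite G] (h : G) (k : ℕ) :
    tilde h * of ℤ G (h ^ k)⁻¹ = tilde h := by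
  conv_lhs => rw [← tilde_mul_of_pow h k, mul_assoc, of_mul_of_inv, mul_one]

theorem tilde_mul_one_sub {G : Type*} [Group G] [Finite G] (h : G) :
    tilde h * (1 - of ℤ G h) = 0 := by
  rw [mul_sub, mul_one, tilde_mul_of, sub_self]

theorem one_sub_mul_tilde {G : Type*} [Group G] [Finite G] (h : G) :
    (1 - of ℤ G h) * tilde h = 0 := by
  rw [sub_mul, one_mul, of_mul_tilde, sub_self]

/-- The Bovdi unit `h ^ k + (1 - h) * g * tilde h`, as a unit of `ℤG`. -/
noncomputable def bovdiRight {G : Type*} [Group G] [Finite G] (k : ℕ) (g h : G) :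
    (MonoidAlgebra ℤ G)ˣ where
  val := of ℤ G (h ^ k) + (1 - of ℤ G h) * of ℤ G g * tilde h
  inv := of ℤ G (h ^ k)⁻¹ - of ℤ G (h ^ k)⁻¹ * ((1 - of ℤ G h) * of ℤ G g * tilde h)
  val_inv := by
    have h1 := of_mul_of_inv (h ^ k)
    have h2 := tilde_mul_of_pow_inv h k
    have h3 := tilde_mul_one_sub h
    generalize of ℤ G (h ^ k) = a at *
    generalize of ℤ G (h ^ k)⁻¹ = b at *
    generalize tilde h = t at *
    generalize of ℤ G g = c at *
    generalize 1 - of ℤ G h = d at *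
    calc (a + d * c * t) * (b - b * (d * c * t))
        = a * b - (a * b) * (d * c * t) + d * c * (t * b) - d * c * (t * b * d) * c * t := by
          noncomm_ring
      _ = 1 := by rw [h1, h2, h3]; noncomm_ring
  inv_val := by
    have h1 := of_inv_mul_of (h ^ k)
    have h2 := tilde_mul_of_pow h k
    have h3 := tilde_mul_one_sub h
    generalize of ℤ G (h ^ k) = a at *
    generalize of ℤ G (h ^ k)⁻¹ = b at *
    generalize tilde h = t at *
    generalize of ℤ G g = c at *
    generalize 1 - of ℤ G h = d at *
    calc (b - b * (d * c * t)) * (a + d * c * t)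
        = b * a + b * (d * c * t) - b * d * c * (t * a) - b * d * c * (t * d) * c * t := by
          noncomm_ring
      _ = 1 := by rw [h1, h2, h3]; noncomm_ring

/-- The Bovdi unit `h ^ k + tilde h * g * (1 - h)`, as a unit of `ℤG`. -/
noncomputable def bovdiLeft {G : Type*} [Group G] [Finite G] (k : ℕ) (h g : G) :
    (MonoidAlgebra ℤ G)ˣ where
  val := of ℤ G (h ^ k) + tilde h * of ℤ G g * (1 - of ℤ G h)
  inv := of ℤ G (h ^ k)⁻¹ - tilde h * of ℤ G g * (1 - of ℤ G h) * of ℤ G (h ^ k)⁻¹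
  val_inv := by
    have h1 := of_mul_of_inv (h ^ k)
    have h2 := of_pow_mul_tilde h k
    have h3 := one_sub_mul_tilde h
    generalize of ℤ G (h ^ k) = a at *
    generalize of ℤ G (h ^ k)⁻¹ = b at *
    generalize tilde h = t at *
    generalize of ℤ G g = c at *
    generalize 1 - of ℤ G h = d at *
    calc (a + t * c * d) * (b - t * c * d * b)
        = a * b - (a * t) * c * d * b + t * c * d * b - t * c * (d * t) * c * d * b := by
          noncomm_ring
      _ = 1 := by rw [h1, h2, h3]; noncomm_ring
  inv_val := by
    have h1 := of_inv_mul_of (h ^ k)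
    have h2 := of_pow_inv_mul_tilde h k
    have h3 := one_sub_mul_tilde h
    generalize of ℤ G (h ^ k) = a at *
    generalize of ℤ G (h ^ k)⁻¹ = b at *
    generalize tilde h = t at *
    generalize of ℤ G g = c at *
    generalize 1 - of ℤ G h = d at *
    calc (b - t * c * d * b) * (a + t * c * d)
        = b * a + (b * t) * c * d - t * c * d * (b * a) - t * c * (d * (b * t)) * c * d := by
          noncomm_ring
      _ = 1 := by rw [h1, h2, h3]; noncomm_ring

theorem involution_one {G : Type*} [Group G] :
    involution (1 : MonoidAlgebra ℤ G) = 1 := by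
  simp [involution, MonoidAlgebra.one_def]

theorem involution_mul {G : Type*} [Group G] (a b : MonoidAlgebra ℤ G) :
    involution (a * b) = involution b * involution a := by
  unfold involution
  induction a using MonoidAlgebra.induction_linear with
  | zero => simp
  | add x y hx hy => simp only [add_mul, mul_add, mapDomain_add, hx, hy]
  | single x r =>
    induction b using MonoidAlgebra.induction_linear with
    | zero => simp
    | add y z hy hz => simp only [add_mul, mul_add, mapDomain_add, hy, hz]
    | single y s =>
      simp only [single_mul_single, mapDomain_single, mul_inv_rev, mul_comm r s]

/-- The image of a unit of `ℤG` under the classical involution, as a unit of `ℤG`. -/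
noncomputable def unitInvolution {G : Type*} [Group G] (u : (MonoidAlgebra ℤ G)ˣ) :
    (MonoidAlgebra ℤ G)ˣ where
  val := involution (u : MonoidAlgebra ℤ G)
  inv := involution ((u⁻¹ : (MonoidAlgebra ℤ G)ˣ) : MonoidAlgebra ℤ G)
  val_inv := by rw [← involution_mul, Units.inv_mul, involution_one]
  inv_val := by rw [← involution_mul, Units.mul_inv, involution_one]

/-- The free product `C_n ⋆ C_n` of two cyclic groups of order `n` (written multiplicatively). -/
abbrev freeProdCyclic (n : ℕ) : Type :=
  Monoid.Coprod (Multiplicative (ZMod n)) (Multiplicative (ZMod n))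

end BovdiUnits

/-!
Let `h` have prime order `p` and let `g` not normalize `⟨h⟩`. Everything in the direct part takes
place on a plane. Put `x = g⁻¹ h g`, so that `x ∉ ⟨h⟩`. In the nilpotent group `⟨h, x⟩` a maximal
subgroup above `⟨h⟩` is normal and does not contain `x`, so for every `p`-th root of unity `ζ` there
is a linear character of `⟨h, x⟩` with `h ↦ 1` and `x ↦ ζ`
(`exists_character_of_notMem_zpowers`). Hence the regular representation contains a vector `v ≠ 0`
with `h v = v` and `h (g v) = ζ (g v)`. As `h̃` multiplies `v` by `p` and kills `g v`, the Bovdi units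
preserve the plane with basis `v`, `g v`, and act on it by the triangular matrices
`[1, 0; p (1 - ζ), ζ ^ k]` and `[1, p (1 - ξ); 0, ξ ^ l]`, where `ξ = ζ` for `b_l(h̃, g⁻¹)` and
`ξ = ζ⁻¹` for `b_l(g, h̃)^*`, which is the unit `h⁻ˡ + h̃ g⁻¹ (1 - h⁻¹)`.

For `ζ` at maximal distance from `1`, `|1 - ζ| ≥ |1 - ζ ^ k|`, and the off-diagonal entry of the
`i`-th power has absolute value at least `p |1 - ω|` for some `p`-th root of unity `ω ≠ 1`. This
exceeds `2`, because `p = ∑ (1 - ω ^ j) ≤ |1 - ω| p (p - 1) / 2`. So the powers exchange the regions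
`|x| < |y|` and `|y| < |x|` of the plane, and both push `v + g v` off the boundary: ping-pong
applies, even for `p = 2`.

For the converse, if `G` normalizes all its subgroups of order `p`, then its elements of order `p`
are central, by nilpotency. Let `u ∈ ℤG` with `u ^ p = 1`. Modulo `p` the coefficient of `u ^ p` at
`1` is the sum of the coefficients of `u` at the solutions of `x ^ p = 1` (`coeff_one_pow_prime`),
so `u` has a nonzero coefficient at such an `x`, which is central. The Berman–Higman theorem
(`eq_one_or_eq_neg_one_of_coeff_one_ne_zero`), applied to `u x⁻¹`, gives `u = ± x`. So all such units
are central, whereas the two factors of `C_p ⋆ C_p` do not commute.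
-/

namespace BovdiUnits

open MonoidAlgebra

/-! ### Ping-pong for two cyclic groups -/

open Monoid Pointwise in
/-- Ping-pong with a base point outside all the ping-pong sets. The base point replaces the usual
assumption that some factor has at least three elements, so that infinite dihedral groups are
covered. -/
theorem coprodI_lift_injective_of_base_point {ι : Type*} {H : ι → Type*} [∀ i, Group (H i)]
    {U α : Type*} [Group U] [MulAction U α] (f : ∀ i, H i →* U) (X : ι → Set α) (a : α)
    (hpp : ∀ i j, i ≠ j → ∀ h : H i, h ≠ 1 → ∀ x ∈ X j, f i h • x ∈ X i)
    (ha : ∀ i, a ∉ X i) (hbase : ∀ i, ∀ h : H i, h ≠ 1 → f i h • a ∈ X i) :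
    Function.Injective (CoprodI.lift f) := by
  classical
  have hpp' : Pairwise fun i j => ∀ h : H i, h ≠ 1 → (f i h • X j : Set α) ⊆ X i := by
    rintro i j hij h hh _ ⟨x, hx, rfl⟩
    exact hpp i j hij h hh x hx
  have key : ∀ {i j} (w : CoprodI.NeWord H i j), CoprodI.lift f w.prod • a ∈ X i := by
    intro i j w
    induction w with
    | singleton x hx => simpa using hbase _ x hx
    | append w₁ hne w₂ _ ih₂ =>
      rw [CoprodI.NeWord.append_prod, map_mul, mul_smul]
      exact CoprodI.lift_word_ping_pong f X hpp' w₁ hne ⟨_, ih₂, rfl⟩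
  refine (injective_iff_map_eq_one _).mpr ?_
  rw [(CoprodI.Word.equiv).forall_congr_left]
  intro w hw
  by_contra hne
  obtain ⟨i, j, w, rfl⟩ := CoprodI.NeWord.of_word w fun h => hne (by rw [h]; rfl)
  have h1 : CoprodI.lift f w.prod = 1 := hw
  have h2 := key w
  rw [h1, one_smul] at h2
  exact ha i h2

open Monoid in
theorem coprod_lift_injective_of_base_point {M U α : Type*} [Group M] [Group U] [MulAction U α]
    (f g : M →* U) (X Y : Set α) (a : α) (haX : a ∉ X) (haY : a ∉ Y)
    (hfY : ∀ m, m ≠ 1 → ∀ y ∈ Y, f m • y ∈ X) (hfa : ∀ m, m ≠ 1 → f m • a ∈ X)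
    (hgX : ∀ m, m ≠ 1 → ∀ x ∈ X, g m • x ∈ Y) (hga : ∀ m, m ≠ 1 → g m • a ∈ Y) :
    Function.Injective (Coprod.lift f g) := by
  let F : Bool → M →* U := fun b => cond b f g
  let Φ : Coprod M M →* CoprodI (fun _ : Bool => M) :=
    Coprod.lift (CoprodI.of (M := fun _ : Bool => M) (i := true))
      (CoprodI.of (M := fun _ : Bool => M) (i := false))
  let Ψ : CoprodI (fun _ : Bool => M) →* Coprod M M :=
    CoprodI.lift fun b => cond b Coprod.inl Coprod.inr
  have hΨ : Ψ.comp Φ = MonoidHom.id _ := by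
    ext x <;> simp [Ψ, Φ]
  have hF : (CoprodI.lift F).comp Φ = Coprod.lift f g := by
    ext x <;> simp [F, Φ]
  have hinj : Function.Injective (CoprodI.lift F) := by
    refine coprodI_lift_injective_of_base_point F (fun b => cond b X Y) a ?_ ?_ ?_
    · rintro (_ | _) (_ | _) hij m hm x hx
      · exact absurd rfl hij
      · exact hgX m hm x hx
      · exact hfY m hm x hx
      · exact absurd rfl hij
    · rintro (_ | _)
      exacts [haY, haX]
    · rintro (_ | _) m hm
      exacts [hga m hm, hfa m hm]
  rw [← hF, MonoidHom.coe_comp]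
  exact hinj.comp (Function.LeftInverse.injective (g := Ψ) fun x => DFunLike.congr_fun hΨ x)

theorem ofAdd_one_mem_zpowers {p : ℕ} (x : Multiplicative (ZMod p)) :
    x ∈ Subgroup.zpowers (Multiplicative.ofAdd (1 : ZMod p)) := by
  obtain ⟨n, hn⟩ := ZMod.intCast_surjective x.toAdd
  refine ⟨n, ?_⟩
  change Multiplicative.ofAdd 1 ^ n = x
  rw [← ofAdd_zsmul, zsmul_one, hn, ofAdd_toAdd]

/-- A ping-pong criterion for two elements of order dividing `p` to generate `C_p ⋆ C_p`. -/
theorem nonempty_closure_pair_mulEquiv_freeProdCyclic {U α : Type*} [Group U] [MulAction U α]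
    {p : ℕ} [NeZero p] {u v : U} (hu : u ^ p = 1) (hv : v ^ p = 1) (X Y : Set α) (a : α)
    (haX : a ∉ X) (haY : a ∉ Y)
    (huY : ∀ i, ¬ p ∣ i → ∀ y ∈ Y, u ^ i • y ∈ X) (hua : ∀ i, ¬ p ∣ i → u ^ i • a ∈ X)
    (hvX : ∀ i, ¬ p ∣ i → ∀ x ∈ X, v ^ i • x ∈ Y) (hva : ∀ i, ¬ p ∣ i → v ^ i • a ∈ Y) :
    Nonempty (Subgroup.closure {u, v} ≃* freeProdCyclic p) := by
  have horder : orderOf (Multiplicative.ofAdd (1 : ZMod p)) = p := by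
    rw [orderOf_ofAdd_eq_addOrderOf, ZMod.addOrderOf_one]
  let hom (w : U) (hw : w ^ p = 1) : Multiplicative (ZMod p) →* U :=
    monoidHomOfForallMemZpowers (g := Multiplicative.ofAdd (1 : ZMod p)) (g' := w)
      ofAdd_one_mem_zpowers (by rw [horder]; exact orderOf_dvd_of_pow_eq_one hw)
  have hom_gen (w : U) (hw : w ^ p = 1) : hom w hw (Multiplicative.ofAdd 1) = w :=
    monoidHomOfForallMemZpowers_apply_gen _ _
  have hom_eq (w : U) (hw : w ^ p = 1) (m : Multiplicative (ZMod p)) (hm : m ≠ 1) :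
      ∃ i : ℕ, ¬ p ∣ i ∧ hom w hw m = w ^ i := by
    have hmi : m = Multiplicative.ofAdd (1 : ZMod p) ^ m.toAdd.val := by
      rw [← ofAdd_nsmul, nsmul_one, ZMod.natCast_zmod_val, ofAdd_toAdd]
    refine ⟨m.toAdd.val, fun hdvd => hm ?_, ?_⟩
    · rw [hmi]
      exact orderOf_dvd_iff_pow_eq_one.mp (horder.symm ▸ hdvd)
    · conv_lhs => rw [hmi, map_pow, hom_gen w hw]
  have hrange (w : U) (hw : w ^ p = 1) : (hom w hw).range = Subgroup.zpowers w := by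
    rw [MonoidHom.range_eq_map, ← (Subgroup.eq_top_iff' _).mpr ofAdd_one_mem_zpowers,
      MonoidHom.map_zpowers, hom_gen w hw]
  have hinj : Function.Injective (Monoid.Coprod.lift (hom u hu) (hom v hv)) := by
    refine coprod_lift_injective_of_base_point _ _ X Y a haX haY ?_ ?_ ?_ ?_
    · intro m hm
      obtain ⟨i, hi, h⟩ := hom_eq u hu m hm
      rw [h]
      exact huY i hi
    · intro m hm
      obtain ⟨i, hi, h⟩ := hom_eq u hu m hm
      rw [h]
      exact hua i hi
    · intro m hm
      obtain ⟨i, hi, h⟩ := hom_eq v hv m hm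
      rw [h]
      exact hvX i hi
    · intro m hm
      obtain ⟨i, hi, h⟩ := hom_eq v hv m hm
      rw [h]
      exact hva i hi
  have hcl : Subgroup.closure {u, v} = (Monoid.Coprod.lift (hom u hu) (hom v hv)).range := by
    rw [Monoid.Coprod.range_lift, hrange u hu, hrange v hv, Subgroup.zpowers_eq_closure,
      Subgroup.zpowers_eq_closure, ← Subgroup.closure_union, Set.singleton_union]
  rw [hcl]
  exact ⟨(MonoidHom.ofInjective hinj).symm⟩

/-! ### Roots of unity -/

/-- The `p`-th roots of unity other than `1` keep a distance of more than `2 / p` from `1`. -/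
theorem two_lt_mul_norm_one_sub {p : ℕ} (hp : 2 ≤ p) {ω : ℂ} (hω : ω ^ p = 1) (hω1 : ω ≠ 1) :
    2 < p * ‖1 - ω‖ := by
  have hnorm : ‖ω‖ = 1 := Complex.norm_eq_one_of_pow_eq_one hω (by omega)
  have hgeom : ∑ j ∈ Finset.range p, ω ^ j = 0 := by
    rw [geom_sum_eq hω1, hω, sub_self, zero_div]
  have hbound : ∀ j : ℕ, ‖1 - ω ^ j‖ ≤ j * ‖1 - ω‖ := by
    intro j
    rw [← mul_neg_geom_sum, norm_mul, mul_comm]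
    gcongr
    calc ‖∑ i ∈ Finset.range j, ω ^ i‖ ≤ ∑ i ∈ Finset.range j, ‖ω ^ i‖ := norm_sum_le _ _
      _ = j := by simp [hnorm]
  -- Since the powers of `ω` sum to zero, `p = ∑ (1 - ω ^ j)`.
  have hsum : (p : ℝ) ≤ (∑ j ∈ Finset.range p, (j : ℝ)) * ‖1 - ω‖ := by
    calc (p : ℝ) = ‖∑ j ∈ Finset.range p, (1 - ω ^ j)‖ := by
          rw [Finset.sum_sub_distrib, hgeom]; simp
      _ ≤ ∑ j ∈ Finset.range p, ‖1 - ω ^ j‖ := norm_sum_le _ _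
      _ ≤ ∑ j ∈ Finset.range p, (j : ℝ) * ‖1 - ω‖ := Finset.sum_le_sum fun j _ => hbound j
      _ = _ := by rw [Finset.sum_mul]
  have hgauss : (∑ j ∈ Finset.range p, (j : ℝ)) * 2 = p * (p - 1) := by
    have := Finset.sum_range_id_mul_two p
    rw [← Nat.cast_sum]
    rw [← Nat.cast_pred (by omega : 0 < p)]
    exact_mod_cast this
  have hp' : (2 : ℝ) ≤ p := by exact_mod_cast hp
  have hpos : 0 < ‖1 - ω‖ := norm_pos_iff.mpr (sub_ne_zero.mpr (Ne.symm hω1))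
  have h1 : (p : ℝ) * 2 ≤ p * ((p - 1) * ‖1 - ω‖) := by
    calc (p : ℝ) * 2 ≤ (∑ j ∈ Finset.range p, (j : ℝ)) * ‖1 - ω‖ * 2 := by gcongr
      _ = p * ((p - 1) * ‖1 - ω‖) := by rw [mul_right_comm, hgauss, mul_assoc]
  have h2 : 2 ≤ (p - 1) * ‖1 - ω‖ := le_of_mul_le_mul_left h1 (by linarith)
  linarith

theorem norm_one_sub_inv {ω : ℂ} (hω : ‖ω‖ = 1) : ‖1 - ω⁻¹‖ = ‖1 - ω‖ := by
  have hω0 : ω ≠ 0 := norm_ne_zero_iff.mp (by rw [hω]; exact one_ne_zero)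
  rw [show 1 - ω⁻¹ = -(ω⁻¹ * (1 - ω)) by field_simp; ring, norm_neg, norm_mul, norm_inv, hω,
    inv_one, one_mul]

/-- A `p`-th root of unity as far away from `1` as possible. -/
theorem exists_farthest_rootOfUnity {p : ℕ} (hp : 2 ≤ p) :
    ∃ ζ : ℂ, ζ ^ p = 1 ∧ ζ ≠ 1 ∧ ∀ ω : ℂ, ω ^ p = 1 → ‖1 - ω‖ ≤ ‖1 - ζ‖ := by
  have hmem (ω : ℂ) : ω ∈ Polynomial.nthRootsFinset p (1 : ℂ) ↔ ω ^ p = 1 :=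
    Polynomial.mem_nthRootsFinset (by omega) 1
  obtain ⟨ζ, hζ, hmax⟩ := (Polynomial.nthRootsFinset p (1 : ℂ)).exists_max_image
    (fun ω => ‖1 - ω‖) ⟨1, by simp [hmem]⟩
  refine ⟨ζ, (hmem ζ).mp hζ, ?_, fun ω hω => hmax ω ((hmem ω).mpr hω)⟩
  rintro rfl
  have hprim := Complex.isPrimitiveRoot_exp p (by omega)
  have h1 := hmax _ ((hmem _).mpr hprim.pow_eq_one)
  rw [sub_self, norm_zero, norm_le_zero_iff, sub_eq_zero] at h1
  exact hprim.ne_one (by omega) h1.symm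

/-! ### Triangular operators on a plane -/

section Plane

variable {V : Type*} [AddCommGroup V] [Module ℂ V]

/-- The vectors of the plane spanned by `e` and `f` whose coordinate at `e` is smaller in absolute
value than the one at `f`. -/
def cone (e f : V) : Set V := {w | ∃ x y : ℂ, ‖x‖ < ‖y‖ ∧ w = x • e + y • f}

theorem add_notMem_cone {e f : V} (hef : LinearIndependent ℂ ![e, f]) : e + f ∉ cone e f := by
  rintro ⟨x, y, hxy, h⟩
  have h' := (LinearIndependent.pair_iff.mp hef) (1 - x) (1 - y) (by
    rw [sub_smul, sub_smul, one_smul, one_smul, sub_add_sub_comm, ← h, sub_self])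
  have hx : x = 1 := (sub_eq_zero.mp h'.1).symm
  have hy : y = 1 := (sub_eq_zero.mp h'.2).symm
  simp [hx, hy] at hxy

theorem smul_mem_cone {e f w : V} (hw : w ∈ cone e f) {a : ℂ} (ha : a ≠ 0) :
    a • w ∈ cone e f := by
  obtain ⟨x, y, hxy, rfl⟩ := hw
  refine ⟨a * x, a * y, ?_, by rw [smul_add, smul_smul, smul_smul]⟩
  rw [norm_mul, norm_mul]
  exact mul_lt_mul_of_pos_left hxy (norm_pos_iff.mpr ha)

theorem pow_apply_of_triangular (T : Module.End ℂ V) {e f : V} {c ω : ℂ}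
    (he : T e = e + c • f) (hf : T f = ω • f) (x y : ℂ) (i : ℕ) :
    (T ^ i) (x • e + y • f) =
      x • e + (x * (c * ∑ j ∈ Finset.range i, ω ^ j) + ω ^ i * y) • f := by
  induction i with
  | zero => simp
  | succ i ih =>
    rw [pow_succ', Module.End.mul_apply, ih, map_add, map_smul, map_smul, he, hf, geom_sum_succ,
      pow_succ]
    module

/-- A triangular operator of order `p` whose off-diagonal entry is large moves the nonzero
vectors of the plane outside the cone into the cone. -/
theorem pow_apply_mem_cone {p : ℕ} (hp : p.Prime) (T : Module.End ℂ V) {e f : V} {c ω : ℂ}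
    (he : T e = e + c • f) (hf : T f = ω • f) (hω : ω ^ p = 1) (hω1 : ω ≠ 1)
    (hc : p * ‖1 - ω‖ ≤ ‖c‖) {i : ℕ} (hi : ¬ p ∣ i) {x y : ℂ} (hx : x ≠ 0) (hyx : ‖y‖ ≤ ‖x‖) :
    (T ^ i) (x • e + y • f) ∈ cone e f := by
  refine ⟨_, _, ?_, pow_apply_of_triangular T he hf x y i⟩
  have hnorm : ‖ω‖ = 1 := Complex.norm_eq_one_of_pow_eq_one hω hp.ne_zero
  have hωi : ω ^ i ≠ 1 := by
    intro h
    have := orderOf_eq_prime hω hω1 (hp := ⟨hp⟩)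
    exact hi (this ▸ orderOf_dvd_of_pow_eq_one h)
  have hpos : 0 < ‖1 - ω‖ := norm_pos_iff.mpr (sub_ne_zero.mpr (Ne.symm hω1))
  have hS : 2 < ‖c * ∑ j ∈ Finset.range i, ω ^ j‖ := by
    have h2 := two_lt_mul_norm_one_sub hp.two_le (ω := ω ^ i)
      (by rw [← pow_mul, mul_comm, pow_mul, hω, one_pow]) hωi
    rw [← mul_neg_geom_sum, norm_mul, ← mul_assoc] at h2
    rw [norm_mul]
    exact h2.trans_le (by gcongr)
  set S := c * ∑ j ∈ Finset.range i, ω ^ j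
  have hxpos : 0 < ‖x‖ := norm_pos_iff.mpr hx
  have h1 : ‖x * S‖ ≤ ‖x * S + ω ^ i * y‖ + ‖ω ^ i * y‖ := by
    simpa using norm_sub_le (x * S + ω ^ i * y) (ω ^ i * y)
  rw [norm_mul x S, norm_mul (ω ^ i) y, norm_pow, hnorm, one_pow, one_mul] at h1
  nlinarith

/-- Two elements of order dividing `p`, acting on a plane by an upper and a lower triangular matrix
with sufficiently large off-diagonal entries, generate `C_p ⋆ C_p`. -/
theorem nonempty_closure_pair_mulEquiv_freeProdCyclic_of_triangular {U : Type*} [Group U] {p : ℕ}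
    (hp : p.Prime) {u v : U} (hu : u ^ p = 1) (hv : v ^ p = 1) (θ : U →* Module.End ℂ V)
    {e f : V} (hef : LinearIndependent ℂ ![e, f]) {c d ω η : ℂ}
    (hue : θ u e = e + c • f) (huf : θ u f = ω • f) (hω : ω ^ p = 1) (hω1 : ω ≠ 1)
    (hc : p * ‖1 - ω‖ ≤ ‖c‖)
    (hvf : θ v f = η • f + d • e) (hve : θ v e = e) (hη : η ^ p = 1) (hη1 : η ≠ 1)
    (hd : p * ‖1 - η‖ ≤ ‖d‖) :
    Nonempty (Subgroup.closure {u, v} ≃* freeProdCyclic p) := by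
  have : NeZero p := ⟨hp.ne_zero⟩
  let _ : MulAction U V := MulAction.compHom V θ
  have hsmul (w : U) (i : ℕ) (x : V) : w ^ i • x = (θ w ^ i) x := by
    rw [← map_pow]; rfl
  -- Dividing `v` by `η` exchanges the roles of the two diagonal entries.
  have hηn : ‖η‖ = 1 := Complex.norm_eq_one_of_pow_eq_one hη hp.ne_zero
  have hη0 : η ≠ 0 := norm_ne_zero_iff.mp (by rw [hηn]; exact one_ne_zero)
  set T := η⁻¹ • θ v with hT
  have hvT (i : ℕ) (x : V) : v ^ i • x = η ^ i • (T ^ i) x := by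
    rw [hsmul, hT, smul_pow, LinearMap.smul_apply, smul_smul, ← mul_pow, mul_inv_cancel₀ hη0,
      one_pow, one_smul]
  have hTf : T f = f + (η⁻¹ * d) • e := by
    rw [hT, LinearMap.smul_apply, hvf, smul_add, smul_smul, smul_smul, inv_mul_cancel₀ hη0,
      one_smul]
  have hTe : T e = η⁻¹ • e := by rw [hT, LinearMap.smul_apply, hve]
  have hη' : η⁻¹ ^ p = 1 := by rw [inv_pow, hη, inv_one]
  have hd' : p * ‖1 - η⁻¹‖ ≤ ‖η⁻¹ * d‖ := by
    rwa [norm_one_sub_inv hηn, norm_mul, norm_inv, hηn, inv_one, one_mul]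
  have hv_mem {i : ℕ} (hi : ¬ p ∣ i) {x y : ℂ} (hx : x ≠ 0) (hyx : ‖y‖ ≤ ‖x‖) :
      v ^ i • (x • f + y • e) ∈ cone f e := by
    rw [hvT]
    exact smul_mem_cone
      (pow_apply_mem_cone hp T hTf hTe hη' (inv_ne_one.mpr hη1) hd' hi hx hyx) (pow_ne_zero i hη0)
  have hfe : LinearIndependent ℂ ![f, e] := LinearIndependent.pair_symm_iff.mp hef
  refine nonempty_closure_pair_mulEquiv_freeProdCyclic hu hv (cone e f) (cone f e) (e + f)
    (add_notMem_cone hef) (add_comm f e ▸ add_notMem_cone hfe) ?_ ?_ ?_ ?_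
  · rintro i hi _ ⟨y, x, hyx, rfl⟩
    rw [hsmul, add_comm]
    exact pow_apply_mem_cone hp _ hue huf hω hω1 hc hi
      (norm_pos_iff.mp ((norm_nonneg y).trans_lt hyx)) hyx.le
  · intro i hi
    simpa [hsmul] using pow_apply_mem_cone hp _ hue huf hω hω1 hc hi (x := 1) (y := 1)
      one_ne_zero le_rfl
  · rintro i hi _ ⟨y, x, hyx, rfl⟩
    rw [add_comm]
    exact hv_mem hi
      (norm_pos_iff.mp ((norm_nonneg y).trans_lt hyx)) hyx.le
  · intro i hi
    rw [add_comm]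
    simpa using hv_mem hi (x := 1) (y := 1) one_ne_zero le_rfl

end Plane

/-! ### Characters of nilpotent groups -/

/-- In a finite nilpotent group, an element `x` with `x ^ p = 1` outside `⟨h⟩` is separated from `h`
by a linear character of a subgroup that contains both. The subgroup is `A = ⟨h, x⟩`; a maximal
subgroup `M` of `A` above `⟨h⟩` is normal, and `A / M` is generated by the image of `x`. -/
theorem exists_character_of_notMem_zpowers {G : Type*} [Group G] [Finite G] [Group.IsNilpotent G]
    {p : ℕ} [Fact p.Prime] {h x : G} (hx : x ^ p = 1) (hxh : x ∉ Subgroup.zpowers h)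
    {ζ : ℂˣ} (hζ : ζ ^ p = 1) :
    ∃ (A : Subgroup G) (χ : A →* ℂˣ) (hA : h ∈ A) (xA : x ∈ A),
      χ ⟨h, hA⟩ = 1 ∧ χ ⟨x, xA⟩ = ζ := by
  have hA : h ∈ Subgroup.closure {h, x} := Subgroup.subset_closure (by simp)
  have xA : x ∈ Subgroup.closure {h, x} := Subgroup.subset_closure (by simp)
  set A := Subgroup.closure {h, x}
  let h₀ : A := ⟨h, hA⟩
  let x₀ : A := ⟨x, xA⟩
  have hgen : ∀ M : Subgroup A, h₀ ∈ M → x₀ ∈ M → M = ⊤ := by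
    intro M hM xM
    have hle : A ≤ M.map A.subtype := by
      refine (Subgroup.closure_le _).mpr ?_
      rintro y (rfl | rfl)
      exacts [⟨h₀, hM, rfl⟩, ⟨x₀, xM, rfl⟩]
    refine (Subgroup.eq_top_iff' _).mpr fun y => ?_
    obtain ⟨z, hz, hzy⟩ := hle y.2
    rwa [← Subtype.ext (a1 := z) (a2 := y) hzy]
  have hne : Subgroup.zpowers h₀ ≠ ⊤ := by
    intro htop
    have : x₀ ∈ Subgroup.zpowers h₀ := htop ▸ Subgroup.mem_top _
    obtain ⟨n, hn⟩ := this
    exact hxh ⟨n, congrArg Subtype.val hn⟩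
  obtain ⟨M, hM, hle⟩ := (eq_top_or_exists_le_coatom (Subgroup.zpowers h₀)).resolve_left hne
  have hnormal : M.Normal :=
    Subgroup.NormalizerCondition.normal_of_coatom M Group.normalizerCondition_of_isNilpotent hM
  have hhM : h₀ ∈ M := hle (Subgroup.mem_zpowers h₀)
  have hxM : x₀ ∉ M := fun hmem => hM.1 (hgen M hhM hmem)
  have hcyc : ∀ y : A ⧸ M, y ∈ Subgroup.zpowers (x₀ : A ⧸ M) := by
    have : (Subgroup.zpowers (x₀ : A ⧸ M)).comap (QuotientGroup.mk' M) = ⊤ := by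
      refine hgen _ ?_ ?_
      · rw [Subgroup.mem_comap, QuotientGroup.mk'_apply, (QuotientGroup.eq_one_iff h₀).mpr hhM]
        exact one_mem _
      · exact Subgroup.mem_zpowers (x₀ : A ⧸ M)
    intro y
    obtain ⟨y, rfl⟩ := QuotientGroup.mk'_surjective M y
    have hy : y ∈ (Subgroup.zpowers (x₀ : A ⧸ M)).comap (QuotientGroup.mk' M) :=
      this ▸ Subgroup.mem_top y
    exact hy
  have horder : orderOf (x₀ : A ⧸ M) = p := by
    refine orderOf_eq_prime ?_ fun h1 => hxM ((QuotientGroup.eq_one_iff x₀).mp h1)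
    rw [← QuotientGroup.mk_pow, show x₀ ^ p = 1 from Subtype.ext hx, QuotientGroup.mk_one]
  have hdvd : orderOf ζ ∣ orderOf (x₀ : A ⧸ M) := by
    rw [horder]
    exact orderOf_dvd_of_pow_eq_one hζ
  let ψ : A ⧸ M →* ℂˣ := monoidHomOfForallMemZpowers hcyc hdvd
  refine ⟨A, ψ.comp (QuotientGroup.mk' M), hA, xA, ?_, ?_⟩
  · change ψ (QuotientGroup.mk' M h₀) = 1
    rw [QuotientGroup.mk'_apply, (QuotientGroup.eq_one_iff h₀).mpr hhM, map_one]
  · exact monoidHomOfForallMemZpowers_apply_gen hcyc hdvd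

/-- A vector in the regular representation (on functions) that transforms under a subgroup by the
character of `exists_character_of_notMem_zpowers`. -/
theorem exists_simultaneous_eigenvector {G : Type*} [Group G] [Finite G] [Group.IsNilpotent G]
    {p : ℕ} [Fact p.Prime] {h x : G} (hx : x ^ p = 1) (hxh : x ∉ Subgroup.zpowers h)
    {ζ : ℂ} (hζ : ζ ^ p = 1) :
    ∃ (ρ : G →* Module.End ℂ (G → ℂ)) (v : G → ℂ), v ≠ 0 ∧ ρ h v = v ∧ ρ x v = ζ • v := by
  classical
  obtain ⟨A, χ, hA, xA, hχh, hχx⟩ := exists_character_of_notMem_zpowers hx hxh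
    (ζ := Units.ofPowEqOne ζ p hζ (Fact.out : p.Prime).ne_zero) (Units.pow_ofPowEqOne _ _)
  let ρ : G →* Module.End ℂ (G → ℂ) :=
    { toFun := fun g => LinearMap.funLeft ℂ ℂ fun y => g⁻¹ * y
      map_one' := by ext; simp [LinearMap.funLeft]
      map_mul' := fun a b => by ext; simp [LinearMap.funLeft, mul_assoc] }
  let v : G → ℂ := fun y => if hy : y ∈ A then ((χ ⟨y, hy⟩)⁻¹ : ℂˣ) else 0
  have hv : ∀ a : A, ρ a v = (χ a : ℂ) • v := by
    intro a
    ext y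
    change v ((a : G)⁻¹ * y) = (χ a : ℂ) * v y
    by_cases hy : y ∈ A
    · have hay : (a : G)⁻¹ * y ∈ A := A.mul_mem (A.inv_mem a.2) hy
      have : (⟨(a : G)⁻¹ * y, hay⟩ : A) = a⁻¹ * ⟨y, hy⟩ := rfl
      simp only [v, dif_pos hy, dif_pos hay, this, map_mul, map_inv, mul_inv, inv_inv,
        Units.val_mul]
    · have hay : (a : G)⁻¹ * y ∉ A := fun h' => hy ((A.mul_mem_cancel_left (A.inv_mem a.2)).mp h')
      simp only [v, dif_neg hy, dif_neg hay, mul_zero]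
  refine ⟨ρ, v, fun h0 => ?_, ?_, ?_⟩
  · have : v 1 = 1 := by
      simp only [v, dif_pos A.one_mem]
      rw [show (⟨1, A.one_mem⟩ : A) = 1 from rfl, map_one, inv_one, Units.val_one]
    rw [h0] at this
    exact zero_ne_one this
  · simpa [hχh] using hv ⟨h, hA⟩
  · simpa [hχx] using hv ⟨x, xA⟩

/-! ### Bovdi units and the involution -/

theorem add_pow_of_mul_eq {R : Type*} [Ring R] {a n : R} (hna : n * a = n) (hnn : n * n = 0)
    (i : ℕ) : (a + n) ^ i = a ^ i + (∑ j ∈ Finset.range i, a ^ j) * n := by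
  induction i with
  | zero => simp
  | succ i ih =>
    rw [pow_succ, ih, Finset.sum_range_succ, pow_succ, add_mul, mul_add, mul_add, mul_assoc _ n a,
      hna, mul_assoc _ n n, hnn, mul_zero, add_zero, add_mul]
    abel

theorem bovdiRight_pow_eq_one {G : Type*} [Group G] [Finite G] {p k : ℕ} {g h : G}
    (hh : orderOf h = p) (hk : k.Coprime p) : bovdiRight k g h ^ p = 1 := by
  set n : MonoidAlgebra ℤ G := (1 - of ℤ G h) * of ℤ G g * tilde h with hn
  set a : MonoidAlgebra ℤ G := of ℤ G (h ^ k) with ha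
  have hap : a ^ p = 1 := by
    rw [ha, ← map_pow, ← pow_mul, mul_comm, pow_mul, ← hh, pow_orderOf_eq_one, one_pow, map_one]
  obtain ⟨m, hm⟩ := exists_pow_eq_self_of_coprime (hh.symm ▸ hk)
  set S := ∑ j ∈ Finset.range p, a ^ j
  have hSa : S * a = S := by
    have h0 : S * (a - 1) = 0 := by rw [geom_sum_mul, hap, sub_self]
    rwa [mul_sub, mul_one, sub_eq_zero] at h0
  have hSpow : ∀ m : ℕ, S * a ^ m = S := by
    intro m
    induction m with
    | zero => simp
    | succ m ih => rw [pow_succ, ← mul_assoc, ih, hSa]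
  have hSh : S * (1 - of ℤ G h) = 0 := by
    have := hSpow m
    rw [ha, ← map_pow, hm] at this
    rw [mul_sub, this, mul_one, sub_self]
  refine Units.ext ?_
  change (a + n) ^ p = 1
  rw [add_pow_of_mul_eq, hap, hn, mul_assoc (1 - _), ← mul_assoc S, hSh, zero_mul, add_zero]
  · rw [hn, mul_assoc, ha, tilde_mul_of_pow]
  · rw [hn, mul_assoc _ (tilde h), ← mul_assoc (tilde h), ← mul_assoc (tilde h), tilde_mul_one_sub,
      zero_mul, zero_mul, mul_zero]

theorem involution_of {G : Type*} [Group G] (x : G) :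
    involution (of ℤ G x) = of ℤ G x⁻¹ := by
  simp [involution]

theorem involution_add {G : Type*} [Group G] (a b : MonoidAlgebra ℤ G) :
    involution (a + b) = involution a + involution b := by
  simp [involution, mapDomain_add]

theorem involution_one_sub {G : Type*} [Group G] (x : G) :
    involution (1 - of ℤ G x) = 1 - of ℤ G x⁻¹ := by
  rw [eq_sub_iff_add_eq, ← involution_of, ← involution_add, sub_add_cancel, involution_one]

theorem tilde_inv {G : Type*} [Group G] [Finite G] (h : G) : tilde h⁻¹ = tilde h := by
  unfold tilde
  rw [Subgroup.zpowers_inv]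

theorem involution_tilde {G : Type*} [Group G] [Finite G] (h : G) :
    involution (tilde h) = tilde h := by
  have hsum : ∀ s : Finset G, involution (∑ x ∈ s, of ℤ G x) = ∑ x ∈ s, of ℤ G x⁻¹ := by
    classical
    intro s
    induction s using Finset.induction_on with
    | empty => simp [involution]
    | insert x s hx ih => rw [Finset.sum_insert hx, Finset.sum_insert hx, involution_add, ih,
        involution_of]
  unfold tilde tildeSet
  rw [hsum]
  exact Finset.sum_equiv (Equiv.inv G) (by simp) (by simp)

theorem unitInvolution_pow {G : Type*} [Group G] (u : (MonoidAlgebra ℤ G)ˣ) (i : ℕ) :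
    unitInvolution u ^ i = unitInvolution (u ^ i) := by
  refine Units.ext ?_
  rw [Units.val_pow_eq_pow_val]
  change involution (u : MonoidAlgebra ℤ G) ^ i = involution (u ^ i : (MonoidAlgebra ℤ G)ˣ)
  induction i with
  | zero => simp [involution_one]
  | succ i ih => rw [pow_succ', ih, pow_succ, Units.val_mul, involution_mul]

theorem unitInvolution_one {G : Type*} [Group G] :
    unitInvolution (1 : (MonoidAlgebra ℤ G)ˣ) = 1 :=
  Units.ext involution_one

theorem unitInvolution_bovdiRight {G : Type*} [Group G] [Finite G] (k : ℕ) (g h : G) :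
    unitInvolution (bovdiRight k g h) = bovdiLeft k h⁻¹ g⁻¹ := by
  refine Units.ext ?_
  change involution (of ℤ G (h ^ k) + (1 - of ℤ G h) * of ℤ G g * tilde h) =
    of ℤ G (h⁻¹ ^ k) + tilde h⁻¹ * of ℤ G g⁻¹ * (1 - of ℤ G h⁻¹)
  rw [involution_add, involution_of, involution_mul, involution_mul, involution_of,
    involution_tilde, involution_one_sub, tilde_inv, inv_pow, mul_assoc]

theorem bovdiLeft_pow_eq_one {G : Type*} [Group G] [Finite G] {p k : ℕ} {g h : G}
    (hh : orderOf h = p) (hk : k.Coprime p) : bovdiLeft k h g ^ p = 1 := by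
  have h1 : bovdiLeft k h g = unitInvolution (bovdiRight k g⁻¹ h⁻¹) := by
    rw [unitInvolution_bovdiRight, inv_inv, inv_inv]
  rw [h1, unitInvolution_pow, bovdiRight_pow_eq_one (by rwa [orderOf_inv]) hk, unitInvolution_one]

/-! ### The action on a representation -/

section Representation

variable {G V : Type*} [Group G] [AddCommGroup V] [Module ℂ V]
  (ρ : G →* Module.End ℂ V) {h : G} {v : V}

/-- The action of `ℤG` on a complex representation of `G`. -/
noncomputable def act : MonoidAlgebra ℤ G →+* Module.End ℂ V :=
  (MonoidAlgebra.lift ℤ (Module.End ℂ V) G ρ : MonoidAlgebra ℤ G →ₐ[ℤ] Module.End ℂ V)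

theorem act_of (x : G) : act ρ (of ℤ G x) = ρ x := by
  simp [act]

theorem act_tilde_of_fixed [Finite G] (hv : ρ h v = v) : act ρ (tilde h) v = (orderOf h : ℂ) • v := by
  have hz : ∀ x ∈ Subgroup.zpowers h, ρ x v = v := by
    rintro x hx
    obtain ⟨n, rfl⟩ := mem_powers_iff_mem_zpowers.mpr hx
    change ρ (h ^ n) v = v
    rw [map_pow, Module.End.pow_apply]
    exact Function.iterate_fixed hv n
  unfold tilde tildeSet
  rw [map_sum, LinearMap.sum_apply, Finset.sum_congr rfl (g := fun _ => v), Finset.sum_const,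
    ← Nat.cast_smul_eq_nsmul ℂ, ← Nat.card_zpowers, ← Set.ncard_eq_toFinset_card,
    ← Nat.card_coe_set_eq]
  · rfl
  · intro x hx
    rw [act_of]
    exact hz x (by simpa using hx)

theorem act_tilde_of_eigenvector [Finite G] {ζ : ℂ} (hζ : ζ ≠ 1) (hv : ρ h v = ζ • v) :
    act ρ (tilde h) v = 0 := by
  have h1 : act ρ (tilde h) (ρ h v) = act ρ (tilde h) v := by
    rw [← act_of, ← Module.End.mul_apply, ← map_mul, tilde_mul_of]
  rw [hv, map_smul, ← sub_eq_zero, ← one_smul ℂ (act ρ (tilde h) v), smul_smul, ← sub_smul,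
    smul_eq_zero, mul_one, sub_eq_zero] at h1
  exact h1.resolve_left hζ

theorem pow_apply_of_eigenvector {ζ : ℂ} (hv : ρ h v = ζ • v) (k : ℕ) :
    ρ (h ^ k) v = ζ ^ k • v := by
  induction k with
  | zero => simp
  | succ k ih => rw [pow_succ, map_mul, Module.End.mul_apply, hv, map_smul, ih, smul_smul, pow_succ']

theorem bovdiRight_act_of_fixed [Finite G] {k : ℕ} {g : G} {ζ : ℂ} (hv : ρ h v = v)
    (hgv : ρ h (ρ g v) = ζ • ρ g v) :
    act ρ (bovdiRight k g h) v = v + (orderOf h * (1 - ζ) : ℂ) • ρ g v := by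
  change act ρ (of ℤ G (h ^ k) + (1 - of ℤ G h) * of ℤ G g * tilde h) v = _
  rw [map_add, map_mul, map_mul, map_sub, map_one, act_of, act_of, act_of, LinearMap.add_apply,
    Module.End.mul_apply, Module.End.mul_apply, act_tilde_of_fixed ρ hv, map_smul,
    pow_apply_of_eigenvector ρ (ζ := 1) (by rwa [one_smul]), LinearMap.sub_apply,
    Module.End.one_apply, map_smul, hgv]
  module

theorem bovdiRight_act_of_eigenvector [Finite G] {k : ℕ} {g : G} {ζ : ℂ} (hζ : ζ ≠ 1)
    (hv : ρ h v = ζ • v) : act ρ (bovdiRight k g h) v = ζ ^ k • v := by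
  change act ρ (of ℤ G (h ^ k) + (1 - of ℤ G h) * of ℤ G g * tilde h) v = _
  rw [map_add, map_mul, act_of, LinearMap.add_apply, Module.End.mul_apply,
    act_tilde_of_eigenvector ρ hζ hv, map_zero, add_zero, pow_apply_of_eigenvector ρ hv]

theorem bovdiLeft_act_of_fixed [Finite G] {k : ℕ} {g : G} (hv : ρ h v = v) :
    act ρ (bovdiLeft k h g) v = v := by
  change act ρ (of ℤ G (h ^ k) + tilde h * of ℤ G g * (1 - of ℤ G h)) v = _
  rw [map_add, map_mul _ _ (1 - of ℤ G h), map_sub, map_one, act_of, act_of, LinearMap.add_apply,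
    Module.End.mul_apply, LinearMap.sub_apply, hv, Module.End.one_apply, sub_self, map_zero,
    add_zero, pow_apply_of_eigenvector ρ (ζ := 1) (by rwa [one_smul]), one_pow, one_smul]

theorem bovdiLeft_act_of_eigenvector [Finite G] {k : ℕ} {g : G} {ζ : ℂ} (hv : ρ h v = v)
    (hgv : ρ h (ρ g v) = ζ • ρ g v) :
    act ρ (bovdiLeft k h g⁻¹) (ρ g v) = ζ ^ k • ρ g v + (orderOf h * (1 - ζ) : ℂ) • v := by
  have hginv : ρ g⁻¹ (ρ g v) = v := by
    rw [← Module.End.mul_apply, ← map_mul, inv_mul_cancel, map_one, Module.End.one_apply]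
  change act ρ (of ℤ G (h ^ k) + tilde h * of ℤ G g⁻¹ * (1 - of ℤ G h)) (ρ g v) = _
  rw [map_add, map_mul, map_mul, map_sub, map_one, act_of, act_of, act_of, LinearMap.add_apply,
    Module.End.mul_apply, Module.End.mul_apply, pow_apply_of_eigenvector ρ hgv,
    LinearMap.sub_apply, Module.End.one_apply, hgv, map_sub, map_smul, hginv, map_sub, map_smul,
    act_tilde_of_fixed ρ hv]
  module

end Representation

/-! ### Bovdi units on an invariant plane -/

/-- For `s = h` or `s = h⁻¹`, a right Bovdi unit at `h` and a left Bovdi unit at `s` generate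
`C_p ⋆ C_p`. -/
theorem nonempty_closure_bovdi_mulEquiv_freeProdCyclic {G : Type*} [Group G] [Finite G]
    [Group.IsNilpotent G] {p : ℕ} (hp : p.Prime) {g h s : G}
    (hg : g ∉ Subgroup.normalizer (Subgroup.zpowers h : Set G)) (hh : orderOf h = p)
    (hs : s = h ∨ s = h⁻¹) {k l : ℕ} (hk : k.Coprime p) (hl : l.Coprime p) :
    Nonempty (Subgroup.closure {bovdiRight k g h, bovdiLeft l s g⁻¹} ≃* freeProdCyclic p) := by
  have : Fact p.Prime := ⟨hp⟩
  have hconj : g⁻¹ * h * g ∉ Subgroup.zpowers h := by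
    intro hmem
    refine hg (inv_mem_iff.mp (Subgroup.mem_normalizer_fintype fun n hn => ?_))
    obtain ⟨i, rfl⟩ := hn
    rw [inv_inv]
    have := zpow_mem hmem i
    rwa [show g⁻¹ * h * g = g⁻¹ * h * g⁻¹⁻¹ by rw [inv_inv], conj_zpow, inv_inv] at this
  obtain ⟨ζ, hζ, hζ1, hmax⟩ := exists_farthest_rootOfUnity hp.two_le
  obtain ⟨ρ, v, hv0, hv, hxv⟩ := exists_simultaneous_eigenvector (h := h) (x := g⁻¹ * h * g)
    (by rw [show g⁻¹ * h * g = g⁻¹ * h * g⁻¹⁻¹ by rw [inv_inv], conj_pow, ← hh,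
      pow_orderOf_eq_one, mul_one, mul_inv_cancel]) hconj hζ
  have hgv : ρ h (ρ g v) = ζ • ρ g v := by
    rw [← map_smul, ← hxv, ← Module.End.mul_apply, ← Module.End.mul_apply, ← map_mul, ← map_mul]
    congr 2
    group
  have hgv0 : ρ g v ≠ 0 := by
    intro h0
    apply hv0
    have := congrArg (ρ g⁻¹) h0
    rwa [map_zero, ← Module.End.mul_apply, ← map_mul, inv_mul_cancel, map_one,
      Module.End.one_apply] at this
  have hlin : LinearIndependent ℂ ![v, ρ g v] := by
    rw [LinearIndependent.pair_iff]
    intro a b hab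
    have h1 := congrArg (ρ h) hab
    rw [map_zero, map_add, map_smul, map_smul, hv, hgv] at h1
    have hb : (b * (1 - ζ)) • ρ g v = 0 := by
      rw [← sub_eq_zero.mpr (hab.trans h1.symm)]
      module
    have hb0 : b = 0 := by
      have := (smul_eq_zero.mp hb).resolve_right hgv0
      exact (mul_eq_zero.mp this).resolve_right (sub_ne_zero.mpr (Ne.symm hζ1))
    rw [hb0, zero_smul, add_zero] at hab
    exact ⟨(smul_eq_zero.mp hab).resolve_right hv0, hb0⟩
  -- The unit at `s` acts with `ξ = ζ` or `ξ = ζ⁻¹` in place of `ζ`.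
  obtain ⟨ξ, hξ, hξ1, hξn, hsv, hsgv, hso⟩ : ∃ ξ : ℂ, ξ ^ p = 1 ∧ ξ ≠ 1 ∧ ‖1 - ξ‖ = ‖1 - ζ‖ ∧
      ρ s v = v ∧ ρ s (ρ g v) = ξ • ρ g v ∧ orderOf s = p := by
    rcases hs with rfl | rfl
    · exact ⟨ζ, hζ, hζ1, rfl, hv, hgv, hh⟩
    · have hinv (w : G → ℂ) : ρ h⁻¹ (ρ h w) = w := by
        rw [← Module.End.mul_apply, ← map_mul, inv_mul_cancel, map_one, Module.End.one_apply]
      have hζ0 : ζ ≠ 0 := fun h0 => by simp [h0, hp.ne_zero] at hζ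
      refine ⟨ζ⁻¹, by rw [inv_pow, hζ, inv_one], inv_ne_one.mpr hζ1, ?_, ?_, ?_, ?_⟩
      · exact norm_one_sub_inv (Complex.norm_eq_one_of_pow_eq_one hζ hp.ne_zero)
      · conv_lhs => rw [← hv, hinv]
      · rw [eq_inv_smul_iff₀ hζ0, ← map_smul, ← hgv, hinv]
      · rw [orderOf_inv, hh]
  have hpow_ne {ω : ℂ} (hω : ω ^ p = 1) (hω1 : ω ≠ 1) {m : ℕ} (hm : m.Coprime p) : ω ^ m ≠ 1 := by
    intro h1
    have := Nat.dvd_gcd (orderOf_dvd_of_pow_eq_one h1) (orderOf_dvd_of_pow_eq_one hω)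
    rw [hm, Nat.dvd_one, orderOf_eq_one_iff] at this
    exact hω1 this
  have hpow_pow {ω : ℂ} (hω : ω ^ p = 1) (m : ℕ) : (ω ^ m) ^ p = 1 := by
    rw [← pow_mul, mul_comm, pow_mul, hω, one_pow]
  refine nonempty_closure_pair_mulEquiv_freeProdCyclic_of_triangular hp
    (bovdiRight_pow_eq_one hh hk) (bovdiLeft_pow_eq_one hso hl)
    ((act ρ : MonoidAlgebra ℤ G →* Module.End ℂ (G → ℂ)).comp (Units.coeHom _)) hlin
    (bovdiRight_act_of_fixed ρ hv hgv) (bovdiRight_act_of_eigenvector ρ hζ1 hgv)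
    (hpow_pow hζ k) (hpow_ne hζ hζ1 hk) ?_
    (bovdiLeft_act_of_eigenvector ρ hsv hsgv) (bovdiLeft_act_of_fixed ρ hsv)
    (hpow_pow hξ l) (hpow_ne hξ hξ1 hl) ?_
  · rw [hh, norm_mul, Complex.norm_natCast]
    exact mul_le_mul_of_nonneg_left (hmax _ (hpow_pow hζ k)) p.cast_nonneg
  · rw [hso, norm_mul, Complex.norm_natCast, hξn]
    exact mul_le_mul_of_nonneg_left (hmax _ (hpow_pow hξ l)) p.cast_nonneg

/-! ### The coefficient at `1` of a `p`-th power -/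

/-- A sum modulo `p` that is invariant under a map with `σ^[p] = id` reduces to its fixed
points. -/
theorem sum_eq_sum_fixed_of_iterate_eq {S : Type*} [Fintype S] [DecidableEq S] {p : ℕ}
    [Fact p.Prime] (σ : S → S) (hσ : σ^[p] = id) (F : S → ZMod p) (hF : ∀ s, F (σ s) = F s) :
    ∑ s, F s = ∑ s with σ s = s, F s := by
  -- On each level set of `F` the number of fixed points is congruent to the number of points.
  have hcard : ∀ c : ZMod p, (({s | F s = c} : Finset S).card : ZMod p) =
      (({s ∈ ({s | σ s = s} : Finset S) | F s = c} : Finset S).card : ZMod p) := by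
    intro c
    let τ : Function.End {s // F s = c} := fun s => ⟨σ s, (hF s).trans s.2⟩
    have hτ : τ ^ p ^ 1 = 1 := by
      have hval : ∀ (n : ℕ) (s : {s // F s = c}), (((τ ^ n) s : {s // F s = c}) : S) = σ^[n] s := by
        intro n
        induction n with
        | zero => intro s; rfl
        | succ n ih =>
          intro s
          rw [pow_succ, Function.iterate_succ_apply]
          exact ih (τ s)
      funext s
      refine Subtype.ext ?_
      rw [pow_one, hval, hσ]
      rfl
    have h := (ZMod.natCast_eq_natCast_iff _ _ _).mpr (Equiv.Perm.card_fixedPoints_modEq hτ)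
    rw [Fintype.card_subtype] at h
    rw [h]
    congr 1
    rw [← Fintype.card_coe]
    refine Fintype.card_congr
      { toFun := fun s => ⟨s.1.1, ?_⟩
        invFun := fun s => ⟨⟨s.1, ?_⟩, ?_⟩
        left_inv := fun s => rfl
        right_inv := fun s => rfl }
    · have : σ s.1.1 = s.1.1 := congrArg Subtype.val s.2
      simp [this, s.1.2]
    · have := s.2
      simp only [Finset.mem_filter, Finset.mem_univ, true_and] at this
      exact this.2
    · have := s.2
      simp only [Finset.mem_filter, Finset.mem_univ, true_and] at this
      exact Subtype.ext this.1
  rw [← Finset.sum_fiberwise (s := Finset.univ) (g := F),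
    ← Finset.sum_fiberwise (s := ({s | σ s = s} : Finset S)) (g := F)]
  refine Finset.sum_congr rfl fun c _ => ?_
  rw [Finset.sum_congr rfl (g := fun _ => c) (by simp),
    Finset.sum_congr (s₁ := {s ∈ ({s | σ s = s} : Finset S) | F s = c}) rfl (g := fun _ => c)
      (by simp), Finset.sum_const, Finset.sum_const, nsmul_eq_mul, nsmul_eq_mul, hcard]

/-- The expansion of a power in a group ring as a sum over words. -/
theorem pow_eq_sum_words {R G : Type*} [CommRing R] [Group G] [Fintype G]
    (a : MonoidAlgebra R G) (n : ℕ) :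
    a ^ n = ∑ f : Fin n → G, single (List.ofFn f).prod (∏ i, a.coeff (f i)) := by
  induction n with
  | zero => simp [MonoidAlgebra.one_def]
  | succ n ih =>
    have ha : a = ∑ x, single x (a.coeff x) := by
      conv_lhs => rw [← sum_coeff_single a]
      exact Finsupp.sum_fintype _ _ (by simp)
    rw [pow_succ', ih]
    conv_lhs => rw [ha]
    rw [Finset.sum_mul_sum, ← Finset.sum_product', Finset.univ_product_univ]
    refine Fintype.sum_equiv (Fin.consEquiv fun _ => G) _ _ fun x => ?_
    simp [Fin.consEquiv, Fin.prod_univ_succ, List.ofFn_succ, single_mul_single]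

theorem prod_ofFn_comp_finRotate_eq_one {G : Type*} [Group G] {n : ℕ} (f : Fin n → G) :
    (List.ofFn (f ∘ finRotate n)).prod = 1 ↔ (List.ofFn f).prod = 1 := by
  cases n with
  | zero => simp
  | succ n =>
    rw [List.ofFn_succ', List.ofFn_succ, List.concat_eq_append, List.prod_append,
      List.prod_singleton, List.prod_cons, Function.comp_apply, finRotate_last]
    have : (fun i : Fin n => (f ∘ finRotate (n + 1)) i.castSucc) = fun i => f i.succ := by
      funext i
      simp
    rw [this]
    exact mul_eq_one_comm

/-- Modulo a prime `p`, the coefficient of `a ^ p` at `1` is the sum of the coefficients of `a` at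
the solutions of `x ^ p = 1`: the cyclic group of order `p` rotates the words of length `p` with
product `1`, and only constant words are fixed. -/
theorem coeff_one_pow_prime {G : Type*} [Group G] [Fintype G] [DecidableEq G] {p : ℕ}
    [Fact p.Prime] (a : MonoidAlgebra ℤ G) :
    (((a ^ p).coeff 1 : ℤ) : ZMod p) = ∑ x with x ^ p = 1, (a.coeff x : ZMod p) := by
  have hp0 : p ≠ 0 := (Fact.out : p.Prime).ne_zero
  have : NeZero p := ⟨hp0⟩
  let F : (Fin p → G) → ZMod p := fun f =>
    if (List.ofFn f).prod = 1 then ∏ i, (a.coeff (f i) : ZMod p) else 0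
  have hexp : (((a ^ p).coeff 1 : ℤ) : ZMod p) = ∑ f, F f := by
    rw [pow_eq_sum_words, coeff_sum, Finsupp.finsetSum_apply, Int.cast_sum]
    refine Finset.sum_congr rfl fun f _ => ?_
    rw [coeff_single, Finsupp.single_apply]
    simp only [F]
    split_ifs <;> simp
  let σ : (Fin p → G) → (Fin p → G) := fun f => f ∘ finRotate p
  have hσapp : ∀ (m : ℕ) (f : Fin p → G) (i : Fin p), σ^[m] f i = f (i + Fin.ofNat p m) := by
    intro m
    induction m with
    | zero => intro f i; simp
    | succ m ih =>
      intro f i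
      rw [Function.iterate_succ_apply, ih]
      change f (finRotate p _) = _
      rw [finRotate_apply, add_assoc]
      congr 2
      exact Fin.ext (by simp [Fin.val_add])
  have hσ : σ^[p] = id := by
    funext f i
    rw [hσapp]
    simp
  have hF : ∀ f, F (σ f) = F f := by
    intro f
    simp only [F, σ, prod_ofFn_comp_finRotate_eq_one]
    congr 1
    exact Equiv.prod_comp (finRotate p) fun i => (a.coeff (f i) : ZMod p)
  rw [hexp, sum_eq_sum_fixed_of_iterate_eq σ hσ F hF]
  symm
  refine Finset.sum_of_injOn (fun x _ => x) ?_ ?_ ?_ ?_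
  · intro x _ y _ hxy
    exact congrFun hxy 0
  · intro x _
    simp only [Finset.coe_filter, Finset.mem_univ, true_and, Set.mem_ofPred_eq]
    rfl
  · intro f hf hfx
    simp only [Finset.mem_filter, Finset.mem_univ, true_and] at hf
    have hconst : f = fun _ => f 0 := by
      funext i
      have h1 : ∀ m, σ^[m] f = f := fun m => Function.iterate_fixed hf m
      have h2 := congrFun (h1 i) 0
      rw [hσapp] at h2
      simpa using h2
    simp only [F]
    rw [if_neg]
    intro hprod
    refine hfx ⟨f 0, ?_, hconst.symm⟩
    rw [hconst] at hprod
    simpa using hprod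
  · intro x hx
    simp only [Finset.mem_filter, Finset.mem_univ, true_and] at hx
    simp [F, hx, ZMod.pow_card]

/-! ### The Berman–Higman theorem -/

section BermanHigman

open Matrix Polynomial

/-- A complex matrix of finite order whose normalized trace is a positive integer is the identity. -/
theorem eq_one_of_pow_eq_one_of_trace {n : Type*} [Fintype n] [DecidableEq n] [Nonempty n]
    {M : Matrix n n ℂ} {m : ℕ} (hm : 0 < m) (hM : M ^ m = 1) {c : ℤ} (hc : 0 < c)
    (htr : M.trace = Fintype.card n * c) : M = 1 := by
  have hroot : ∀ z ∈ M.charpoly.roots, ‖z‖ = 1 := by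
    intro z hz
    have h1 := spectrum.pow_mem_pow M m
      (Matrix.mem_spectrum_of_isRoot_charpoly (Polynomial.isRoot_of_mem_roots hz))
    rw [hM, spectrum.one_eq, Set.mem_singleton_iff] at h1
    exact Complex.norm_eq_one_of_pow_eq_one h1 hm.ne'
  have hcard : M.charpoly.roots.card = Fintype.card n := by
    rw [← (IsAlgClosed.splits M.charpoly).natDegree_eq_card_roots, M.charpoly_natDegree_eq_dim]
  -- The eigenvalues have absolute value `1` and real parts of average at least `1`.
  have hsum : (M.charpoly.roots.map fun z => 1 - z.re).sum ≤ 0 := by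
    have h1 : (M.charpoly.roots.map fun z => z.re).sum = Fintype.card n * c := by
      have h2 := congrArg Complex.re (htr.symm.trans (Matrix.trace_eq_sum_roots_charpoly M))
      have h3 : M.charpoly.roots.sum.re = (M.charpoly.roots.map fun z => z.re).sum :=
        map_multiset_sum Complex.reAddGroupHom _
      rw [← h3, ← h2]
      simp
    rw [Multiset.sum_map_sub, h1, Multiset.map_const', Multiset.sum_replicate, hcard, nsmul_one]
    have hc' : (1 : ℝ) ≤ c := by exact_mod_cast hc
    nlinarith [(Fintype.card n).cast_nonneg (α := ℝ)]
  have hone : ∀ z ∈ M.charpoly.roots, z = 1 := by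
    intro z hz
    have hnn : ∀ y ∈ M.charpoly.roots.map fun z => 1 - z.re, 0 ≤ y := by
      intro y hy
      obtain ⟨w, hw, rfl⟩ := Multiset.mem_map.mp hy
      exact sub_nonneg.mpr ((Complex.re_le_norm w).trans_eq (hroot w hw))
    have hre : 1 - z.re = 0 := le_antisymm
      ((Multiset.single_le_sum hnn _ (Multiset.mem_map_of_mem _ hz)).trans hsum)
      (hnn _ (Multiset.mem_map_of_mem _ hz))
    have hn := hroot z hz
    have hsq : z.re * z.re + z.im * z.im = 1 := by
      rw [← Complex.normSq_apply, Complex.normSq_eq_norm_sq, hn, one_pow]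
    have hre1 : z.re = 1 := by linarith
    refine Complex.ext hre1 ?_
    rw [hre1] at hsq
    rw [Complex.one_im]
    nlinarith
  have hchar : M.charpoly = (X - C 1) ^ Fintype.card n := by
    rw [(IsAlgClosed.splits M.charpoly).eq_prod_roots_of_monic M.charpoly_monic,
      Multiset.eq_replicate_card.mpr hone]
    simp [hcard]
  -- Since `1` is a simple root of `X ^ m - 1`, the unipotent matrix `M` is the identity.
  have hcop : IsCoprime (∑ i ∈ Finset.range m, X ^ i : ℂ[X]) M.charpoly := by
    rw [hchar]
    refine IsCoprime.pow_right (IsCoprime.symm ?_)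
    refine (Polynomial.irreducible_X_sub_C 1).coprime_iff_not_dvd.mpr ?_
    rw [Polynomial.dvd_iff_isRoot, Polynomial.IsRoot.def, Polynomial.eval_finsetSum]
    simp [hm.ne']
  obtain ⟨a, b, hab⟩ := hcop
  have h1 := congrArg (aeval M) hab
  rw [map_add, map_mul, map_mul, Matrix.aeval_self_charpoly, mul_zero, add_zero, map_one] at h1
  have h2 : aeval M (∑ i ∈ Finset.range m, X ^ i : ℂ[X]) * (M - 1) = 0 := by
    rw [map_sum]
    simp only [map_pow, aeval_X]
    rw [geom_sum_mul, hM, sub_self]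
  have h3 : M - 1 = 0 := by
    calc M - 1 = 1 * (M - 1) := (one_mul _).symm
      _ = 0 := by rw [← congrArg (· * (M - 1)) h1, mul_assoc, h2, mul_zero]
  exact sub_eq_zero.mp h3

/-- Left multiplication by `a` in the regular representation of `ℤG`, as a complex matrix. -/
noncomputable def regularMatrix {G : Type*} [Group G] (a : MonoidAlgebra ℤ G) : Matrix G G ℂ :=
  Matrix.of fun x y => (a.coeff (x * y⁻¹) : ℂ)

theorem regularMatrix_one {G : Type*} [Group G] [DecidableEq G] :
    regularMatrix (1 : MonoidAlgebra ℤ G) = 1 := by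
  ext x y
  simp [regularMatrix, MonoidAlgebra.one_def, Finsupp.single_apply, Matrix.one_apply,
    eq_comm (a := (1 : G)), mul_inv_eq_one]

theorem regularMatrix_mul {G : Type*} [Group G] [Fintype G] (a b : MonoidAlgebra ℤ G) :
    regularMatrix (a * b) = regularMatrix a * regularMatrix b := by
  ext x y
  simp only [regularMatrix, Matrix.of_apply, Matrix.mul_apply]
  rw [coeff_mul_apply_right, Finsupp.sum_fintype _ _ (by simp), Int.cast_sum]
  refine Fintype.sum_equiv (Equiv.mulRight y) _ _ fun z => ?_
  simp [mul_assoc]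

theorem regularMatrix_pow {G : Type*} [Group G] [Fintype G] [DecidableEq G]
    (a : MonoidAlgebra ℤ G) (m : ℕ) : regularMatrix (a ^ m) = regularMatrix a ^ m := by
  induction m with
  | zero => simp [regularMatrix_one]
  | succ m ih => rw [pow_succ, pow_succ, regularMatrix_mul, ih]

theorem regularMatrix_injective {G : Type*} [Group G] :
    Function.Injective (regularMatrix (G := G)) := by
  intro a b hab
  refine coeff_injective (Finsupp.ext fun x => ?_)
  have := congrFun (congrFun hab x) 1
  simpa [regularMatrix] using this

/-- The Berman–Higman theorem: a unit of finite order of `ℤG` whose coefficient at `1` is not zero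
is `1` or `-1`. -/
theorem eq_one_or_eq_neg_one_of_coeff_one_ne_zero {G : Type*} [Group G] [Finite G]
    {a : MonoidAlgebra ℤ G} {m : ℕ} (hm : 0 < m) (ha : a ^ m = 1) (ha1 : a.coeff 1 ≠ 0) :
    a = 1 ∨ a = -1 := by
  classical
  have := Fintype.ofFinite G
  have key : ∀ b : MonoidAlgebra ℤ G, b ^ (2 * m) = 1 → 0 < b.coeff 1 → b = 1 := by
    intro b hb hb1
    refine regularMatrix_injective ?_
    rw [regularMatrix_one]
    refine eq_one_of_pow_eq_one_of_trace (m := 2 * m) (by omega)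
      (by rw [← regularMatrix_pow, hb, regularMatrix_one]) hb1 ?_
    simp [Matrix.trace, regularMatrix]
  have ha2 : a ^ (2 * m) = 1 := by rw [mul_comm, pow_mul, ha, one_pow]
  rcases lt_or_gt_of_ne ha1 with h | h
  · right
    rw [← neg_eq_iff_eq_neg]
    refine key (-a) ?_ ?_
    · rw [Even.neg_pow (even_two_mul m), ha2]
    · rw [MonoidAlgebra.coeff_neg, Finsupp.neg_apply]
      exact neg_pos.mpr h
  · exact Or.inl (key a ha2 h)

end BermanHigman

/-! ### Units of order `p` when the elements of order `p` are central -/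

open scoped commutatorElement in
/-- In a nilpotent group, an element of prime order that generates a normal subgroup is central. -/
theorem mem_center_of_zpowers_normal {G : Type*} [Group G] [Group.IsNilpotent G] {p : ℕ}
    (hp : p.Prime) {x : G} (hx : orderOf x = p)
    (hnorm : ∀ g : G, g ∈ Subgroup.normalizer (Subgroup.zpowers x : Set G)) :
    x ∈ Subgroup.center G := by
  rw [Subgroup.mem_center_iff]
  by_contra! hne
  obtain ⟨g, hg⟩ := hne
  have hc1 : ⁅x, g⁆ ≠ 1 := fun h => hg (commutatorElement_eq_one_iff_mul_comm.mp h).symm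
  have hcx : ⁅x, g⁆ ∈ Subgroup.zpowers x := by
    rw [commutatorElement_def, mul_assoc, mul_assoc, ← mul_assoc g]
    refine mul_mem (Subgroup.mem_zpowers x) ?_
    exact (Subgroup.mem_set_normalizer_iff.mp (hnorm g) x⁻¹).mp
      (inv_mem (Subgroup.mem_zpowers x))
  have hfin : IsOfFinOrder x := orderOf_pos_iff.mp (hx ▸ hp.pos)
  obtain ⟨n, hn⟩ := hfin.mem_powers_iff_mem_zpowers.mpr hcx
  replace hn : x ^ n = ⁅x, g⁆ := hn
  obtain ⟨m, hm⟩ := exists_pow_eq_self_of_coprime (x := x) (n := n) (by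
    rw [hx, Nat.coprime_comm, hp.coprime_iff_not_dvd]
    intro hdvd
    exact hc1 (hn ▸ orderOf_dvd_iff_pow_eq_one.mp (hx ▸ hdvd)))
  -- As a power of `⁅x, g⁆`, the element `x` descends through the whole lower central series.
  have hmem : ∀ i, x ∈ (⊤ : Subgroup G).lowerCentralSeries i := by
    intro i
    induction i with
    | zero => exact Subgroup.mem_top x
    | succ i ih =>
      rw [← hm, hn]
      exact pow_mem (Subgroup.commutator_mem_commutator ih (Subgroup.mem_top g)) m
  obtain ⟨i, hi⟩ := Subgroup.nilpotent_iff_lowerCentralSeries.mp ‹Group.IsNilpotent G›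
  have h1 := hmem i
  rw [hi, Subgroup.mem_bot] at h1
  rw [h1, orderOf_one] at hx
  exact hp.one_lt.ne hx

/-- If all elements of order `p` of `G` are central, then so are all units of order `p` of `ℤG`. -/
theorem commute_of_pow_prime_eq_one {G : Type*} [Group G] [Finite G] {p : ℕ} (hp : p.Prime)
    (hcent : ∀ x : G, orderOf x = p → x ∈ Subgroup.center G) {a : MonoidAlgebra ℤ G}
    (ha : a ^ p = 1) (b : MonoidAlgebra ℤ G) : Commute a b := by
  classical
  have := Fintype.ofFinite G
  have : Fact p.Prime := ⟨hp⟩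
  have hsum := coeff_one_pow_prime (p := p) a
  rw [ha, coeff_one_one, Int.cast_one] at hsum
  obtain ⟨x, hxp, hax⟩ := Finset.exists_ne_zero_of_sum_ne_zero (hsum ▸ one_ne_zero)
  replace hxp : x ^ p = 1 := by simpa using hxp
  have hax : a.coeff x ≠ 0 := fun h => hax (by rw [h, Int.cast_zero])
  have hxc : x ∈ Subgroup.center G := by
    by_cases hx1 : x = 1
    · exact hx1 ▸ one_mem _
    · exact hcent x (orderOf_eq_prime hxp hx1)
  have hcomm : ∀ {y : G}, y ∈ Subgroup.center G → ∀ c, Commute (of ℤ G y) c := by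
    intro y hy c
    induction c using MonoidAlgebra.induction_linear with
    | zero => exact Commute.zero_right _
    | add c d hc hd => exact hc.add_right hd
    | single z r =>
      rw [Commute, SemiconjBy, of_apply, single_mul_single, single_mul_single, mul_comm 1 r,
        Subgroup.mem_center_iff.mp hy z]
  have hpow : (a * of ℤ G x⁻¹) ^ p = 1 := by
    rw [(hcomm (inv_mem hxc) a).symm.mul_pow, ha, ← map_pow, inv_pow, hxp, inv_one, map_one,
      mul_one]
  have hax' : a = a * of ℤ G x⁻¹ * of ℤ G x := by rw [mul_assoc, of_inv_mul_of, mul_one]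
  rcases eq_one_or_eq_neg_one_of_coeff_one_ne_zero hp.pos hpow
    (by simpa [coeff_mul_single_apply] using hax) with h | h
  · rw [hax', h, one_mul]
    exact hcomm hxc b
  · rw [hax', h, neg_one_mul]
    exact (hcomm hxc b).neg_left

/-- The generators of the two factors of `C_p ⋆ C_p` do not commute, since neither do the elementary
matrices of `SL₂(𝔽_p)`. -/
theorem not_commute_inl_inr {p : ℕ} (hp : p.Prime) :
    ¬ Commute (Monoid.Coprod.inl (Multiplicative.ofAdd 1) : freeProdCyclic p)
      (Monoid.Coprod.inr (Multiplicative.ofAdd 1)) := by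
  have : Fact p.Prime := ⟨hp⟩
  intro hcomm
  let f : Multiplicative (ZMod p) →* Matrix (Fin 2) (Fin 2) (ZMod p) :=
    { toFun := fun t => !![1, t.toAdd; 0, 1]
      map_one' := by simp [Matrix.one_fin_two]
      map_mul' := fun s t => by simp [add_comm] }
  let g : Multiplicative (ZMod p) →* Matrix (Fin 2) (Fin 2) (ZMod p) :=
    { toFun := fun t => !![1, 0; t.toAdd, 1]
      map_one' := by simp [Matrix.one_fin_two]
      map_mul' := fun s t => by simp }
  have h := congrFun (congrFun (hcomm.map (Monoid.Coprod.lift f g)).eq 0) 0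
  simp [f, g] at h

end BovdiUnits

theorem mainTheorem1 {G : Type*} [Group G] [Finite G] (hG : Group.IsNilpotent G)
    (p : ℕ) (hp : p.Prime) :
    (∀ g h : G, g ∉ Subgroup.normalizer (Subgroup.zpowers h : Set G) → orderOf h = p →
      ∀ k l : ℕ, 1 ≤ k → k ≤ p - 1 → 1 ≤ l → l ≤ p - 1 →
        Nonempty (Subgroup.closure
            {BovdiUnits.bovdiRight k g h, BovdiUnits.unitInvolution (BovdiUnits.bovdiRight l g h)} ≃*
          BovdiUnits.freeProdCyclic p) ∧
        Nonempty (Subgroup.closure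
            {BovdiUnits.bovdiRight k g h, BovdiUnits.bovdiLeft l h g⁻¹} ≃*
          BovdiUnits.freeProdCyclic p)) ∧
    ((∃ H : Subgroup (MonoidAlgebra ℤ G)ˣ, Nonempty (H ≃* BovdiUnits.freeProdCyclic p)) →
      ∃ g h : G, g ∉ Subgroup.normalizer (Subgroup.zpowers h : Set G) ∧ orderOf h = p) := by
  constructor
  · intro g h hg hh k l hk hk' hl hl'
    have hcop {m : ℕ} (hm : 1 ≤ m) (hm' : m ≤ p - 1) : m.Coprime p :=
      (Nat.coprime_of_lt_prime (by omega) (by have := hp.two_le; omega) hp).symm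
    rw [BovdiUnits.unitInvolution_bovdiRight]
    exact ⟨BovdiUnits.nonempty_closure_bovdi_mulEquiv_freeProdCyclic hp hg hh (Or.inr rfl)
        (hcop hk hk') (hcop hl hl'),
      BovdiUnits.nonempty_closure_bovdi_mulEquiv_freeProdCyclic hp hg hh (Or.inl rfl)
        (hcop hk hk') (hcop hl hl')⟩
  · rintro ⟨H, ⟨e⟩⟩
    by_contra! hall
    have hcent : ∀ x : G, orderOf x = p → x ∈ Subgroup.center G := fun x hx =>
      BovdiUnits.mem_center_of_zpowers_normal hp hx fun g => by
        by_contra hg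
        exact hall g x hg hx
    have hpow : (Multiplicative.ofAdd (1 : ZMod p)) ^ p = 1 := by
      rw [← ofAdd_nsmul, nsmul_one, ZMod.natCast_self, ofAdd_zero]
    have hcomm : Commute (e.symm (Monoid.Coprod.inl (Multiplicative.ofAdd 1)))
        (e.symm (Monoid.Coprod.inr (Multiplicative.ofAdd 1))) := by
      refine Subtype.ext (Units.ext ?_)
      refine (BovdiUnits.commute_of_pow_prime_eq_one hp hcent ?_ _).eq
      rw [← Units.val_pow_eq_pow_val, ← Subgroup.coe_pow, ← map_pow, ← map_pow, hpow, map_one,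
        map_one, Subgroup.coe_one, Units.val_one]
    have := hcomm.map e
    rw [e.apply_symm_apply, e.apply_symm_apply] at this
    exact BovdiUnits.not_commute_inl_inr hp this
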